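/- Let $d\ge 1$ be an integer. For sets $A_1,A_2,\dots\subseteq\mathbb{R}^d$ let $\sum_{k=1}^\infty A_k$ be the set of all $x\in\mathbb{R}^d$ for which there are $a_k\in A_k$ $(k\ge 1)$ such that the series $\sum_{k=1}^\infty a_k$ converges to $x$. Write $\|x\|=\max_i|x_i|$, let $\mathcal{L}^d$ be Lebesgue measure, let $\dim_H$ and $\dim_P$ be the Hausdorff and packing dimensions, let $\#$ denote cardinality, and put $\min\emptyset=\infty$. For each $k\ge1$ let $c_k\ge 1$ and $C_k\ge c_k+1$ be real numbers and let $B_k\subseteq\mathbb{R}^d$ be a finite set with $\emptyset\ne B_k\cap[0,c_k]^d\subseteq\mathbb{Z}^d$. Let $$S=\sum_{k=1}^\infty C_1^{-1}\cdots C_k^{-1}B_k,\qquad m_k=C_1^{-1}\cdots C_k^{-1}\min\{\|x\|:x\in B_k\setminus[0,c_k]^d\}\in[0,\infty].$$ (1) Suppose $\liminf_{k\to\infty}m_k>0$. (a) If $\prod_{k=1}^\infty\frac{\#(B_k\cap[0,c_k]^d)}{C_k^d}=0$ (the partial products tend to $0$), then $\mathcal{L}^d(S)=0$. (b) If $\lim_{k\to\infty}\frac{\log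 C_k}{\log (C_1\cdots C_k)}=0$, then $$\dim_H S=\liminf_{k\to\infty}\frac{\log \prod_{i=1}^k\#(B_i\cap[0,c_i]^d)}{\log (C_1\cdots C_k)}\quad\text{and}\quad \dim_P S=\limsup_{k\to\infty}\frac{\log \prod_{i=1}^k\#(B_i\cap[0,c_i]^d)}{\log (C_1\cdots C_k)}.$$ (2) If $B_k\subseteq[0,\infty)^d$ for all $k\ge1$ and $\lim_{k\to\infty}m_k=\infty$, then $S$ is closed. -/

import Mathlib

open Filter Topology MeasureTheory
open scoped ENNReal NNReal Pointwise

noncomputable section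

namespace InfSum

/-- The set of all sums `∑ a k` with `a k ∈ A k` for every `k`, the series converging in the
usual sense: the partial sums, taken in the given order, converge. -/
def infiniteSum {X : Type*} [AddCommMonoid X] [TopologicalSpace X] (A : ℕ → Set X) : Set X :=
  {x | ∃ a : ℕ → X, (∀ k, a k ∈ A k) ∧
    Tendsto (fun n => ∑ k ∈ Finset.range n, a k) atTop (𝓝 x)}

/-- A `δ`-packing of `F`: a countable family of pairwise disjoint closed balls with centres in `F`
and radii in `(0, δ]`. A ball is given as a pair (centre, radius). -/
def IsPacking {X : Type*} [PseudoMetricSpace X] (F : Set X) (δ : ℝ) (t : Set (X × ℝ)) : Prop :=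
  t.Countable ∧ (∀ p ∈ t, p.1 ∈ F ∧ 0 < p.2 ∧ p.2 ≤ δ) ∧
    t.PairwiseDisjoint (fun p => Metric.closedBall p.1 p.2)

/-- The supremum of `∑ (2 r_i) ^ s` over all `δ`-packings of `F`. In `ℝ^d` with `d ≥ 1`, the
diameter of a ball of radius `r` is `2 r`. -/
def packingContent {X : Type*} [PseudoMetricSpace X] (s : ℝ) (δ : ℝ) (F : Set X) : ℝ≥0∞ :=
  ⨆ (t : Set (X × ℝ)) (_ : IsPacking F δ t), ∑' p : t, ENNReal.ofReal (2 * p.1.2) ^ s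

/-- The packing premeasure: the limit of `packingContent s δ F` as `δ` decreases to `0`, which is
the infimum over `δ > 0` since the content is monotone in `δ`. -/
def packingPremeasure {X : Type*} [PseudoMetricSpace X] (s : ℝ) (F : Set X) : ℝ≥0∞ :=
  ⨅ (δ : ℝ) (_ : 0 < δ), packingContent s δ F

/-- The `s`-dimensional packing (outer) measure. -/
def packingMeasure {X : Type*} [PseudoMetricSpace X] (s : ℝ) (F : Set X) : ℝ≥0∞ :=
  ⨅ (U : ℕ → Set X) (_ : F ⊆ ⋃ i, U i), ∑' i, packingPremeasure s (U i)

/-- The packing dimension `sup {s ≥ 0 : 𝒫^s(F) = ∞}` (with `sup ∅ = 0`). -/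
def dimP {X : Type*} [PseudoMetricSpace X] (F : Set X) : ℝ≥0∞ :=
  ⨆ (s : ℝ≥0) (_ : packingMeasure (s : ℝ) F = ∞), (s : ℝ≥0∞)

/-- The cube `[0, c]^d`. -/
def cube (d : ℕ) (c : ℝ) : Set (EuclideanSpace ℝ (Fin d)) :=
  {x | ∀ i, 0 ≤ x i ∧ x i ≤ c}

/-- The integer lattice `ℤ^d` in `ℝ^d`. -/
def intLattice (d : ℕ) : Set (EuclideanSpace ℝ (Fin d)) :=
  {x | ∀ i, ∃ n : ℤ, x i = (n : ℝ)}

/-- The orthant `[0, ∞)^d`. -/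
def orthant (d : ℕ) : Set (EuclideanSpace ℝ (Fin d)) :=
  {x | ∀ i, 0 ≤ x i}

/-- The product `C 0 * ⋯ * C k` of the first `k + 1` terms; sequences indexed by `1, 2, 3, …` in
print are indexed by `0, 1, 2, …` here. -/
def scale (C : ℕ → ℝ) (k : ℕ) : ℝ := ∏ i ∈ Finset.range (k + 1), C i

/-- `min {‖x‖ : x ∈ F}` for a finite set `F`, with the maximum norm (the norm of `Fin d → ℝ`),
and with `min ∅ = ∞`. -/
def minSupNorm {d : ℕ} (F : Set (EuclideanSpace ℝ (Fin d))) : ℝ≥0∞ :=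
  ⨅ x ∈ F, ‖(x.ofLp : Fin d → ℝ)‖ₑ

/-- `(C 0 ⋯ C k)⁻¹ * min {‖x‖ : x ∈ B k \ [0, c k]^d}`, a value in `[0, ∞]`. -/
def scaledFar {d : ℕ} (c C : ℕ → ℝ) (B : ℕ → Set (EuclideanSpace ℝ (Fin d))) (k : ℕ) : ℝ≥0∞ :=
  ENNReal.ofReal ((scale C k)⁻¹) * minSupNorm (B k \ cube d (c k))

/-- The number of points of `B k` in the cube `[0, c k]^d`. -/
def nearCard {d : ℕ} (c : ℕ → ℝ) (B : ℕ → Set (EuclideanSpace ℝ (Fin d))) (k : ℕ) : ℕ :=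
  (B k ∩ cube d (c k)).ncard

/-- The set `∑_k (C 0 ⋯ C k)⁻¹ B_k`. -/
def digitSum {d : ℕ} (C : ℕ → ℝ) (B : ℕ → Set (EuclideanSpace ℝ (Fin d))) :
    Set (EuclideanSpace ℝ (Fin d)) :=
  infiniteSum (fun k => (scale C k)⁻¹ • B k)

/-- `log (#(B_0 ∩ [0, c_0]^d) ⋯ #(B_k ∩ [0, c_k]^d)) / log (C_0 ⋯ C_k)`. -/
def dimRatio {d : ℕ} (c C : ℕ → ℝ) (B : ℕ → Set (EuclideanSpace ℝ (Fin d))) (k : ℕ) : ℝ :=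
  Real.log (∏ i ∈ Finset.range (k + 1), (nearCard c B i : ℝ)) / Real.log (scale C k)

end InfSum

end

/-!
Write `q n = C 0 ⋯ C (n - 1)` and let `N n` be the number of words of `n` near digits, that is,
digits in the cubes `[0, c k]^d`. Since `c k ≤ C k - 1`, near digits from place `n` on contribute
at most `1 / q n` to each coordinate (`digitPartialSum_sub_mem`), by a telescoping sum. Hence the
sums of near digits are covered by `N n` cubes of side `1 / q n`. By the same estimate, and
because the near digits are integral, different words of length `n` have partial sums at distance
at least `1 / q n` in the maximum norm (`digitPartialSum_separated`). So a set of diameter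
`1 / q n` meets the cubes of a bounded number of words, and the uniform measure on the sequences of near
digits gives it mass at most a constant divided by `N n` (`isFrostman_digitMeasure`).

If `liminf m_k > 0`, the terms with digits outside the cubes (far digits) stay away from `0`, so
that a convergent series has finitely many of them: `S` is a countable union of sets for which all
digits are admitted at the first `K` places and near digits afterwards
(`digitSum_subset_iUnion_nearFrom`). Each of these is covered by a constant times `N n` cubes of
side `1 / q n`. This bounds its volume by a constant times `N n / q n ^ d`, its Hausdorff
dimension by the liminf of `log N n / log q n` (`IsCoveredAtScales.dimH_le`), and, if consecutive
scales are comparable on the logarithmic scale, its packing dimension by the limsup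
(`IsCoveredAtScales.packingPremeasure_eq_zero`). The uniform measure gives the lower bounds: the
mass distribution principle for the Hausdorff dimension (`IsFrostman.le_dimH`), and maximal
separated subsets of a set of positive measure for the packing dimension (`IsFrostman.le_dimP`).

For nonnegative digits each term of a series is bounded by its sum. If `m_k → ∞`, then far digits
occur in bounded parts of `S` only at the first few places, so `S` agrees locally with a compact
set, the continuous image of a product of finite sets (`isCompact_digitSum`).
-/

namespace InfSum

/-! ### Sequences growing at least like powers of two -/

section Growth

variable {q N : ℕ → ℝ}

lemma two_pow_le_of_two_mul_le (hq0 : q 0 = 1) (hq : ∀ n, 2 * q n ≤ q (n + 1)) (n : ℕ) :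
    (2 : ℝ) ^ n ≤ q n := by
  induction n with
  | zero => simp [hq0]
  | succ n ih => rw [pow_succ]; linarith [hq n]

lemma one_le_of_two_mul_le (hq0 : q 0 = 1) (hq : ∀ n, 2 * q n ≤ q (n + 1)) (n : ℕ) :
    1 ≤ q n :=
  (one_le_pow₀ one_le_two).trans (two_pow_le_of_two_mul_le hq0 hq n)

lemma tendsto_atTop_of_two_mul_le (hq0 : q 0 = 1) (hq : ∀ n, 2 * q n ≤ q (n + 1)) :
    Tendsto q atTop atTop :=
  tendsto_atTop_mono (two_pow_le_of_two_mul_le hq0 hq)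
    (tendsto_pow_atTop_atTop_of_one_lt one_lt_two)

lemma le_rpow_of_log_ratio_lt {x y : ℝ} {s : ℝ≥0} (hx : 0 < x) (hy : 1 < y)
    (h : ENNReal.ofReal (Real.log x / Real.log y) < s) : x ≤ y ^ (s : ℝ) := by
  have hly := Real.log_pos hy
  have h1 : Real.log x / Real.log y < s := by
    rw [← ENNReal.ofReal_coe_nnreal] at h
    exact lt_of_not_ge fun h' => absurd h (not_lt.2 (ENNReal.ofReal_le_ofReal h'))
  rw [div_lt_iff₀ hly] at h1
  rw [Real.le_rpow_iff_log_le hx (by linarith)]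
  exact h1.le

lemma rpow_le_of_lt_log_ratio {x y : ℝ} {s : ℝ≥0} (hx : 0 < x) (hy : 1 < y)
    (h : (s : ℝ≥0∞) < ENNReal.ofReal (Real.log x / Real.log y)) : y ^ (s : ℝ) ≤ x := by
  have hly := Real.log_pos hy
  have h1 : (s : ℝ) < Real.log x / Real.log y := by
    rw [← ENNReal.ofReal_coe_nnreal] at h
    exact lt_of_not_ge fun h' => absurd h (not_lt.2 (ENNReal.ofReal_le_ofReal h'))
  rw [lt_div_iff₀ hly] at h1
  rw [← Real.log_le_log_iff (by positivity) hx, Real.log_rpow (by linarith)]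
  exact h1.le

/-- If `log (q (n + 1) / q n)` is negligible against `log q (n + 1)`, then passing from `q n` to
`q (n + 1)` costs only an arbitrarily small increase of the exponent. -/
lemma eventually_rpow_succ_le (hq0 : q 0 = 1) (hq : ∀ n, 2 * q n ≤ q (n + 1))
    (hlog : Tendsto (fun n => Real.log (q (n + 1) / q n) / Real.log (q (n + 1))) atTop (𝓝 0))
    {a b : ℝ} (ha : 0 ≤ a) (hab : a < b) : ∀ᶠ n in atTop, q (n + 1) ^ a ≤ q n ^ b := by
  have hb : 0 < b := ha.trans_lt hab
  have hε : 0 < 1 - a / b := by rw [sub_pos, div_lt_one hb]; exact hab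
  filter_upwards [hlog.eventually_lt_const hε] with n hn
  have h0 : 0 < q n := zero_lt_one.trans_le (one_le_of_two_mul_le hq0 hq n)
  have h1 : 1 < q (n + 1) := by linarith [hq n, one_le_of_two_mul_le hq0 hq n]
  have hl := Real.log_pos h1
  rw [div_lt_iff₀ hl, Real.log_div (by positivity) h0.ne'] at hn
  rw [← Real.log_le_log_iff (by positivity) (by positivity), Real.log_rpow (by linarith),
    Real.log_rpow h0]
  have h2 : a / b * Real.log (q (n + 1)) ≤ Real.log (q n) := by linarith
  calc a * Real.log (q (n + 1)) = b * (a / b * Real.log (q (n + 1))) := by field_simp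
    _ ≤ _ := by gcongr

end Growth

/-! ### Hausdorff dimension from covers and measures along a sequence of scales -/

section Dimension

variable {X : Type*} [MetricSpace X] {q N : ℕ → ℝ}

/-- For all large `n`, the set `F` is covered by a constant times `N n` sets of diameter at most a
constant divided by `q n`. -/
def IsCoveredAtScales (q N : ℕ → ℝ) (F : Set X) : Prop :=
  ∃ A D : ℝ, 0 ≤ A ∧ 0 < D ∧ ∀ᶠ n in atTop, ∃ t : Finset (Set X), (t.card : ℝ) ≤ A * N n ∧
    (∀ U ∈ t, ∀ x ∈ U, ∀ y ∈ U, dist x y ≤ D / q n) ∧ F ⊆ ⋃ U ∈ t, U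

/-- Only the scales along which the liminf is approached are used, so the ratios
`q (n + 1) / q n` may be arbitrary. -/
theorem IsCoveredAtScales.dimH_le [MeasurableSpace X] [BorelSpace X]
    (hq0 : q 0 = 1) (hq : ∀ n, 2 * q n ≤ q (n + 1))
    (hN : ∀ n, 0 < N n) {F : Set X} (hF : IsCoveredAtScales q N F) :
    dimH F ≤
      liminf (fun n => ENNReal.ofReal (Real.log (N (n + 1)) / Real.log (q (n + 1)))) atTop := by
  obtain ⟨A, D, hA, hD, hcov⟩ := hF
  obtain ⟨n₀, hcov⟩ := eventually_atTop.1 hcov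
  have hcov' : ∀ n : ℕ, ∃ t : Finset (Set X), n₀ ≤ n → (t.card : ℝ) ≤ A * N n ∧
    (∀ U ∈ t, ∀ x ∈ U, ∀ y ∈ U, dist x y ≤ D / q n) ∧ F ⊆ ⋃ U ∈ t, U := fun n => by
    by_cases h : n₀ ≤ n
    · obtain ⟨t, ht⟩ := hcov n h
      exact ⟨t, fun _ => ht⟩
    · exact ⟨∅, fun h' => absurd h' h⟩
  choose t ht using hcov'
  have hq1 := one_le_of_two_mul_le hq0 hq
  refine ENNReal.le_of_forall_nnreal_lt fun s hs => ?_
  by_contra! hlt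
  have hfreq := frequently_lt_of_liminf_lt (by isBoundedDefault) hlt
  -- the scales along which the covers are efficient
  let l : Filter ℕ := atTop ⊓ 𝓟 {n | N (n + 1) ≤ q (n + 1) ^ (s : ℝ)}
  have hl : l.NeBot := by
    refine frequently_mem_iff_neBot.1 (hfreq.mono fun n hn => ?_)
    exact le_rpow_of_log_ratio_lt (hN _) (by linarith [hq n, hq1 n]) hn
  have hle : (μH[(s : ℝ)] : Measure X) F ≤ ENNReal.ofReal (A * D ^ (s : ℝ)) := by
    have hdiam : ∀ n, n₀ ≤ n + 1 → ∀ i : t (n + 1),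
        Metric.ediam (i : Set X) ≤ ENNReal.ofReal (D / q (n + 1)) := fun n hn i => by
      refine Metric.ediam_le fun x hx y hy => ?_
      rw [edist_dist]
      exact ENNReal.ofReal_le_ofReal ((ht _ hn).2.1 _ i.2 x hx y hy)
    have hev : ∀ᶠ n in l, n₀ ≤ n + 1 :=
      ((eventually_ge_atTop n₀).mono fun n hn => by omega).filter_mono inf_le_left
    refine (Measure.hausdorffMeasure_le_liminf_sum (s : ℝ) F (l := l)
      (fun n => ENNReal.ofReal (D / q (n + 1))) ?_
      (fun n (i : t (n + 1)) => (i : Set X)) (hev.mono hdiam) ?_).trans ?_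
    · have h1 : Tendsto (fun n => D / q (n + 1)) atTop (𝓝 0) :=
        ((tendsto_atTop_of_two_mul_le hq0 hq).comp (tendsto_add_atTop_nat 1)).const_div_atTop D
      have h2 := ENNReal.tendsto_ofReal h1
      rw [ENNReal.ofReal_zero] at h2
      exact h2.mono_left inf_le_left
    · filter_upwards [hev] with n hn x hx
      have := (ht _ hn).2.2 hx
      simpa using this
    · refine (liminf_le_liminf (v := fun _ => ENNReal.ofReal (A * D ^ (s : ℝ))) ?_).trans
        (liminf_const _).le
      have hmem : ∀ᶠ n in l, N (n + 1) ≤ q (n + 1) ^ (s : ℝ) :=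
        eventually_inf_principal.2 (.of_forall fun _ h => h)
      filter_upwards [hev, hmem] with n hn hNn
      have hqp : 0 < q (n + 1) := zero_lt_one.trans_le (hq1 _)
      calc ∑ i : t (n + 1), Metric.ediam (i : Set X) ^ (s : ℝ)
          ≤ ∑ i : t (n + 1), ENNReal.ofReal (D / q (n + 1)) ^ (s : ℝ) := by
            gcongr with i; exact hdiam n hn i
        _ = (t (n + 1)).card * ENNReal.ofReal ((D / q (n + 1)) ^ (s : ℝ)) := by
            rw [ENNReal.ofReal_rpow_of_pos (by positivity)]; simp
        _ = ENNReal.ofReal ((t (n + 1)).card * (D / q (n + 1)) ^ (s : ℝ)) := by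
            rw [ENNReal.ofReal_mul (by positivity), ENNReal.ofReal_natCast]
        _ ≤ ENNReal.ofReal (A * D ^ (s : ℝ)) := by
            refine ENNReal.ofReal_le_ofReal ?_
            calc ((t (n + 1)).card : ℝ) * (D / q (n + 1)) ^ (s : ℝ)
                ≤ (A * q (n + 1) ^ (s : ℝ)) * (D / q (n + 1)) ^ (s : ℝ) := by
                  gcongr
                  exact (ht _ hn).1.trans (by gcongr)
              _ = A * D ^ (s : ℝ) := by
                  rw [Real.div_rpow hD.le hqp.le]
                  have := (Real.rpow_pos_of_pos hqp (s : ℝ)).ne'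
                  field_simp
  exact absurd (dimH_le_of_hausdorffMeasure_ne_top (hle.trans_lt ENNReal.ofReal_lt_top).ne)
    (not_le.2 hs)

/-- Measures for which every set of diameter at most `1 / q n` has mass at most a constant divided
by `N n`. -/
def IsFrostman [MeasurableSpace X] (q N : ℕ → ℝ) (μ : Measure X) : Prop :=
  ∃ M : ℝ, 0 < M ∧ ∀ n (U : Set X), (∀ x ∈ U, ∀ y ∈ U, dist x y ≤ 1 / q n) →
    μ U ≤ ENNReal.ofReal (M / N n)

/-- The mass distribution principle. A set whose diameter lies between `1 / q (n + 1)` and `1 / q n`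
is measured with the bound at level `n`; the growth condition makes this loss negligible. -/
theorem IsFrostman.le_dimH [MeasurableSpace X] [BorelSpace X]
    (hq0 : q 0 = 1) (hq : ∀ n, 2 * q n ≤ q (n + 1)) (hN : ∀ n, 0 < N n)
    (hlog : Tendsto (fun n => Real.log (q (n + 1) / q n) / Real.log (q (n + 1))) atTop (𝓝 0))
    {μ : Measure X} (hμ : IsFrostman q N μ) {F : Set X} (hF : μ F ≠ 0) :
    liminf (fun n => ENNReal.ofReal (Real.log (N (n + 1)) / Real.log (q (n + 1)))) atTop ≤
      dimH F := by
  obtain ⟨M, hM, hμ⟩ := hμ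
  have hq1 := one_le_of_two_mul_le hq0 hq
  have hqp : ∀ n, 0 < q n := fun n => zero_lt_one.trans_le (hq1 n)
  have hqtop := tendsto_atTop_of_two_mul_le hq0 hq
  refine ENNReal.le_of_forall_nnreal_lt fun s hs => ?_
  rcases eq_or_ne s 0 with rfl | hs0
  · simp
  have hspos : (0 : ℝ) < s := by exact_mod_cast pos_iff_ne_zero.2 hs0
  obtain ⟨s', hss', hs'⟩ := ENNReal.lt_iff_exists_nnreal_btwn.1 hs
  have hss' : (s : ℝ) < s' := by exact_mod_cast hss'
  have hev1 : ∀ᶠ n in atTop, q n ^ (s' : ℝ) ≤ N n := by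
    obtain ⟨a, ha⟩ := eventually_atTop.1 (eventually_lt_of_lt_liminf hs')
    filter_upwards [eventually_ge_atTop (a + 1)] with n hn
    obtain ⟨m, rfl⟩ : ∃ m, n = m + 1 := ⟨n - 1, by omega⟩
    exact rpow_le_of_lt_log_ratio (hN _) (by linarith [hq m, hq1 m]) (ha m (by omega))
  obtain ⟨n₀, hn₀⟩ := eventually_atTop.1
    (hev1.and (eventually_rpow_succ_le hq0 hq hlog hspos.le hss'))
  have hbound : ∀ n, n₀ ≤ n → ENNReal.ofReal (M / N n) ≤
      ENNReal.ofReal M * ENNReal.ofReal (1 / q (n + 1)) ^ (s : ℝ) := fun n hn => by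
    have hp := hqp (n + 1)
    rw [ENNReal.ofReal_rpow_of_pos (by positivity), ← ENNReal.ofReal_mul hM.le]
    refine ENNReal.ofReal_le_ofReal ?_
    rw [Real.div_rpow zero_le_one hp.le, Real.one_rpow, ← div_eq_mul_one_div]
    have := Real.rpow_pos_of_pos hp (s : ℝ)
    gcongr
    exact (hn₀ n hn).2.trans (hn₀ n hn).1
  have key : ENNReal.ofReal (1 / M) • μ ≤ μH[(s : ℝ)] := by
    refine Measure.le_hausdorffMeasure _ _ (ENNReal.ofReal (1 / q n₀))
      (ENNReal.ofReal_pos.2 (one_div_pos.2 (hqp _))) fun U hU => ?_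
    rw [Measure.smul_apply, smul_eq_mul]
    suffices h : μ U ≤ ENNReal.ofReal M * Metric.ediam U ^ (s : ℝ) by
      calc ENNReal.ofReal (1 / M) * μ U
          ≤ ENNReal.ofReal (1 / M) * (ENNReal.ofReal M * Metric.ediam U ^ (s : ℝ)) := by gcongr
        _ = Metric.ediam U ^ (s : ℝ) := by
          rw [← mul_assoc, ← ENNReal.ofReal_mul (by positivity), one_div_mul_cancel hM.ne']
          simp
    -- sets of diameter at most `1 / q n` satisfy the Frostman bound at level `n`
    have hU' : ∀ n, Metric.ediam U ≤ ENNReal.ofReal (1 / q n) → μ U ≤ ENNReal.ofReal (M / N n) :=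
      fun n hn => hμ n U fun x hx y hy => by
        have := (Metric.edist_le_ediam_of_mem hx hy).trans hn
        rwa [edist_dist, ENNReal.ofReal_le_ofReal_iff (one_div_pos.2 (hqp _)).le] at this
    -- if all levels are admissible, `U` has at most one point and measure zero
    by_cases hall : ∀ n, n₀ ≤ n → Metric.ediam U ≤ ENNReal.ofReal (1 / q n)
    · have hlim : Tendsto (fun n => ENNReal.ofReal M * ENNReal.ofReal (1 / q (n + 1)) ^ (s : ℝ))
          atTop (𝓝 0) := by
        have h1 : Tendsto (fun n => ENNReal.ofReal (1 / q (n + 1))) atTop (𝓝 0) := by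
          have := ENNReal.tendsto_ofReal
            ((hqtop.comp (tendsto_add_atTop_nat 1)).const_div_atTop 1)
          rwa [ENNReal.ofReal_zero] at this
        have h2 := (h1.ennrpow_const (s : ℝ))
        rw [ENNReal.zero_rpow_of_pos hspos] at h2
        simpa using ENNReal.Tendsto.const_mul (a := ENNReal.ofReal M) h2
          (Or.inr ENNReal.ofReal_ne_top)
      have : μ U ≤ 0 := ge_of_tendsto hlim <| (eventually_ge_atTop n₀).mono fun n hn =>
        (hU' n (hall n hn)).trans (hbound n hn)
      exact this.trans zero_le
    · push Not at hall
      -- the first level at which `U` is too large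
      classical
      let n := Nat.find hall
      obtain ⟨hn1, hn2⟩ : n₀ ≤ n ∧ ENNReal.ofReal (1 / q n) < Metric.ediam U := Nat.find_spec hall
      have hne : n ≠ n₀ := by
        intro h; rw [h] at hn2; exact absurd hU (not_le.2 hn2)
      obtain ⟨m, hm⟩ : ∃ m, n = m + 1 := ⟨n - 1, by omega⟩
      have hm0 : n₀ ≤ m := by omega
      have hmU : Metric.ediam U ≤ ENNReal.ofReal (1 / q m) := by
        by_contra hcon
        exact Nat.find_min hall (m := m) (by omega) ⟨hm0, not_le.1 hcon⟩
      rw [hm] at hn2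
      refine (hU' m hmU).trans ((hbound m hm0).trans ?_)
      gcongr
  refine le_dimH_of_hausdorffMeasure_ne_zero fun h0 => ?_
  have h1 := key F
  rw [h0, Measure.smul_apply, smul_eq_mul, nonpos_iff_eq_zero, mul_eq_zero,
    ENNReal.ofReal_eq_zero] at h1
  rcases h1 with h1 | h1
  · exact absurd h1 (not_le.2 (by positivity))
  · exact hF h1

end Dimension

/-! ### Packing dimension from covers and measures along a sequence of scales -/

section Packing

variable {X : Type*} [MetricSpace X] {q N : ℕ → ℝ}

/-- The balls of a packing with radii in `(r, R]` have their centres in different sets of any cover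
of `F` by sets of diameter at most `r`. -/
lemma IsPacking.tsum_le_of_cover {F : Set X} {δ : ℝ} {t : Set (X × ℝ)} (ht : IsPacking F δ t)
    {s r R : ℝ} (hs : 0 ≤ s) {cov : Finset (Set X)}
    (hdiam : ∀ U ∈ cov, ∀ x ∈ U, ∀ y ∈ U, dist x y ≤ r) (hcov : F ⊆ ⋃ U ∈ cov, U) :
    ∑' p : {p ∈ t | r < p.2 ∧ p.2 ≤ R}, ENNReal.ofReal (2 * p.1.2) ^ s ≤
      cov.card * ENNReal.ofReal (2 * R) ^ s := by
  have hex : ∀ p : {p ∈ t | r < p.2 ∧ p.2 ≤ R}, ∃ U : cov, p.1.1 ∈ (U : Set X) := fun p => by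
    have := hcov (ht.2.1 p.1 p.2.1).1
    simpa using this
  choose g hg using hex
  have hinj : Function.Injective g := fun p p' h => by
    by_contra hne
    have hdis := ht.2.2 p.2.1 p'.2.1 (fun h => hne (Subtype.ext h))
    refine Set.disjoint_left.1 hdis (Metric.mem_closedBall_self (ht.2.1 p.1 p.2.1).2.1.le) ?_
    rw [Metric.mem_closedBall]
    refine (hdiam _ (g p').2 _ ?_ _ (hg p')).trans p'.2.2.1.le
    rw [← h]
    exact hg p
  calc ∑' p : {p ∈ t | r < p.2 ∧ p.2 ≤ R}, ENNReal.ofReal (2 * p.1.2) ^ s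
      ≤ ∑' p : {p ∈ t | r < p.2 ∧ p.2 ≤ R}, ENNReal.ofReal (2 * R) ^ s := by
        gcongr with p
        exact p.2.2.2
    _ ≤ ∑' _ : cov, ENNReal.ofReal (2 * R) ^ s :=
        ENNReal.tsum_comp_le_tsum_of_injective hinj (fun _ => ENNReal.ofReal (2 * R) ^ s)
    _ = cov.card * ENNReal.ofReal (2 * R) ^ s := by simp

/-- The balls of a packing are grouped by the scale of their radii; for exponents above the limsup
the groups contribute the terms of a convergent geometric series. -/
theorem IsCoveredAtScales.packingPremeasure_eq_zero
    (hq0 : q 0 = 1) (hq : ∀ n, 2 * q n ≤ q (n + 1)) (hN : ∀ n, 0 < N n)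
    (hlog : Tendsto (fun n => Real.log (q (n + 1) / q n) / Real.log (q (n + 1))) atTop (𝓝 0))
    {F : Set X} (hF : IsCoveredAtScales q N F) {s : ℝ≥0}
    (hs : limsup (fun n => ENNReal.ofReal (Real.log (N (n + 1)) / Real.log (q (n + 1)))) atTop
      < s) :
    packingPremeasure (s : ℝ) F = 0 := by
  obtain ⟨A, D, hA, hD, hcov⟩ := hF
  have hq1 := one_le_of_two_mul_le hq0 hq
  have hqp : ∀ n, 0 < q n := fun n => zero_lt_one.trans_le (hq1 n)
  have hqtop := tendsto_atTop_of_two_mul_le hq0 hq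
  obtain ⟨s₁, hs₁, hs₁s⟩ := ENNReal.lt_iff_exists_nnreal_btwn.1 hs
  obtain ⟨s₂, hs₁₂, hs₂s⟩ := exists_between (ENNReal.coe_lt_coe.1 hs₁s)
  have hs₂s' : (s₂ : ℝ) < s := by exact_mod_cast hs₂s
  obtain ⟨n₀, hn₀⟩ := eventually_atTop.1 ((eventually_lt_of_limsup_lt hs₁).and
    ((eventually_rpow_succ_le hq0 hq hlog s₁.coe_nonneg (NNReal.coe_lt_coe.2 hs₁₂)).and
      ((tendsto_add_atTop_nat 1).eventually hcov)))
  -- the contribution of the balls with radii in `(D / q (n + 1), D / q n]` decays geometrically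
  let ρ : ℝ := 2 ^ ((s₂ : ℝ) - s)
  have hρ0 : 0 < ρ := by positivity
  have hρ1 : ρ < 1 := Real.rpow_lt_one_of_one_lt_of_neg one_lt_two (by linarith)
  let K : ℝ := A * (2 * D) ^ (s : ℝ)
  have hlevel : ∀ n, n₀ ≤ n → ∀ δ t, IsPacking F δ t →
      ∑' p : {p ∈ t | D / q (n + 1) < p.2 ∧ p.2 ≤ D / q n}, ENNReal.ofReal (2 * p.1.2) ^ (s : ℝ) ≤
        ENNReal.ofReal (K * ρ ^ n) := fun n hn δ t ht => by
    obtain ⟨h1, h2, cov, hc1, hc2, hc3⟩ := hn₀ n hn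
    refine (ht.tsum_le_of_cover s.coe_nonneg hc2 hc3).trans ?_
    have hNq := le_rpow_of_log_ratio_lt (hN _) (by linarith [hq n, hq1 n]) h1
    have hp := hqp n
    rw [ENNReal.ofReal_rpow_of_pos (by positivity), ← ENNReal.ofReal_natCast,
      ← ENNReal.ofReal_mul (by positivity)]
    refine ENNReal.ofReal_le_ofReal ?_
    calc (cov.card : ℝ) * (2 * (D / q n)) ^ (s : ℝ)
        ≤ (A * q n ^ (s₂ : ℝ)) * (2 * (D / q n)) ^ (s : ℝ) := by
          gcongr
          exact hc1.trans (by gcongr; exact hNq.trans h2)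
      _ = K * q n ^ ((s₂ : ℝ) - s) := by
          rw [← mul_div_assoc, Real.div_rpow (by positivity) hp.le, Real.rpow_sub hp]
          simp only [K]
          ring
      _ ≤ K * ρ ^ n := by
          have : q n ^ ((s₂ : ℝ) - s) ≤ (2 ^ n : ℝ) ^ ((s₂ : ℝ) - s) :=
            Real.rpow_le_rpow_of_nonpos (by positivity) (two_pow_le_of_two_mul_le hq0 hq n)
              (by linarith)
          have h3 : (2 ^ n : ℝ) ^ ((s₂ : ℝ) - s) = ρ ^ n := by
            simp only [ρ]
            rw [← Real.rpow_natCast, ← Real.rpow_natCast, ← Real.rpow_mul zero_le_two,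
              ← Real.rpow_mul zero_le_two, mul_comm]
          rw [← h3]
          gcongr
  have hcontent : ∀ n, n₀ ≤ n → packingContent (s : ℝ) (D / q n) F ≤
      ∑' j, ENNReal.ofReal (K * ρ ^ (j + n)) := fun n hn => by
    refine iSup₂_le fun t ht => ?_
    have hsub : t ⊆ ⋃ j : ℕ, {p ∈ t | D / q (j + n + 1) < p.2 ∧ p.2 ≤ D / q (j + n)} := by
      intro p hp
      have hp2 := ht.2.1 p hp
      have hex : ∃ m, D / q (m + n + 1) < p.2 := by
        have : Tendsto (fun m => D / q (m + (n + 1))) atTop (𝓝 0) :=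
          (hqtop.comp (tendsto_add_atTop_nat (n + 1))).const_div_atTop D
        exact (this.eventually_lt_const hp2.2.1).exists
      classical
      refine Set.mem_iUnion.2 ⟨Nat.find hex, hp, Nat.find_spec hex, ?_⟩
      rcases Nat.eq_zero_or_pos (Nat.find hex) with h0 | h0
      · rw [h0, zero_add]; exact hp2.2.2
      · have := Nat.find_min hex (m := Nat.find hex - 1) (by omega)
        rw [show Nat.find hex - 1 + n + 1 = Nat.find hex + n by omega] at this
        exact not_lt.1 this
    calc ∑' p : t, ENNReal.ofReal (2 * p.1.2) ^ (s : ℝ)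
        ≤ ∑' p : ⋃ j : ℕ, {p ∈ t | D / q (j + n + 1) < p.2 ∧ p.2 ≤ D / q (j + n)},
            ENNReal.ofReal (2 * p.1.2) ^ (s : ℝ) :=
          ENNReal.tsum_mono_subtype (fun p : X × ℝ => ENNReal.ofReal (2 * p.2) ^ (s : ℝ)) hsub
      _ ≤ ∑' j : ℕ, ∑' p : {p ∈ t | D / q (j + n + 1) < p.2 ∧ p.2 ≤ D / q (j + n)},
            ENNReal.ofReal (2 * p.1.2) ^ (s : ℝ) :=
          ENNReal.tsum_iUnion_le_tsum (fun p : X × ℝ => ENNReal.ofReal (2 * p.2) ^ (s : ℝ)) _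
      _ ≤ _ := ENNReal.tsum_le_tsum fun j => hlevel (j + n) (by omega) _ t ht
  have hsum : Summable fun n => K * ρ ^ n :=
    (summable_geometric_of_lt_one hρ0.le hρ1).mul_left K
  have hlim := ENNReal.tendsto_sum_nat_add (fun n => ENNReal.ofReal (K * ρ ^ n))
    hsum.tsum_ofReal_ne_top
  refine le_antisymm (ge_of_tendsto hlim ((eventually_ge_atTop n₀).mono fun n hn => ?_)) zero_le
  exact (iInf₂_le (D / q n) (by have := hqp n; positivity)).trans (hcontent n hn)

theorem dimP_le_of_subset_iUnion (hq0 : q 0 = 1) (hq : ∀ n, 2 * q n ≤ q (n + 1))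
    (hN : ∀ n, 0 < N n)
    (hlog : Tendsto (fun n => Real.log (q (n + 1) / q n) / Real.log (q (n + 1))) atTop (𝓝 0))
    {F : Set X} {T : ℕ → Set X} (hT : ∀ i, IsCoveredAtScales q N (T i)) (hF : F ⊆ ⋃ i, T i) :
    dimP F ≤
      limsup (fun n => ENNReal.ofReal (Real.log (N (n + 1)) / Real.log (q (n + 1)))) atTop := by
  refine iSup₂_le fun s hs => ?_
  by_contra! hlt
  have h0 : packingMeasure (s : ℝ) F ≤ 0 := by
    refine (iInf₂_le T hF).trans ?_
    simp [(hT _).packingPremeasure_eq_zero hq0 hq hN hlog hlt]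
  rw [hs] at h0
  exact absurd h0 (by simp)

/-- A maximal `r`-separated subset of `U` provides a packing of `U` by balls of radius `r / 2`, and
it has at least `μ U / m` elements because the balls of radius `r` around it cover `U`. -/
lemma le_packingContent_of_measure_le [TopologicalSpace.SeparableSpace X] [MeasurableSpace X]
    {μ : Measure X} {s δ r m : ℝ} (hr : 0 < r) (hrδ : r ≤ 2 * δ)
    (hμ : ∀ V : Set X, (∀ x ∈ V, ∀ y ∈ V, dist x y ≤ 2 * r) → μ V ≤ ENNReal.ofReal m)
    (U : Set X) :
    μ U / ENNReal.ofReal m * ENNReal.ofReal r ^ s ≤ packingContent s δ U := by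
  obtain ⟨A, hA⟩ : ∃ A, Maximal (· ∈ {A : Set X | A ⊆ U ∧ Metric.IsSeparated r.toNNReal A}) A := by
    refine zorn_subset _ fun c hc hchain => ⟨⋃₀ c, ⟨Set.sUnion_subset fun A hA => (hc hA).1, ?_⟩,
      fun A hA => Set.subset_sUnion_of_mem hA⟩
    exact (Set.pairwise_sUnion hchain.directedOn).2 fun A hA => (hc hA).2
  have hcov := Metric.isCover_iff_subset_iUnion_closedBall.1
    (Metric.IsCover.of_maximal_isSeparated hA)
  rw [Real.coe_toNNReal _ hr.le] at hcov
  have hsep : ∀ x ∈ A, ∀ y ∈ A, x ≠ y → r < dist x y := fun x hx y hy hxy => by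
    have : ENNReal.ofReal r < edist x y := hA.prop.2 hx hy hxy
    rw [edist_dist] at this
    exact (ENNReal.ofReal_lt_ofReal_iff_of_nonneg hr.le).1 this
  have hdisj : A.PairwiseDisjoint fun x => Metric.closedBall x (r / 2) := fun x hx y hy hxy =>
    Metric.closedBall_disjoint_closedBall (by linarith [hsep x hx y hy hxy])
  have hcount : A.Countable := by
    refine Set.PairwiseDisjoint.countable_of_isOpen (s := fun x => Metric.ball x (r / 2))
      (hdisj.mono fun x => Metric.ball_subset_closedBall) (fun _ _ => Metric.isOpen_ball)
      fun x _ => Metric.nonempty_ball.2 (by positivity)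
  have hinj : Function.Injective fun x : X => (x, r / 2) := fun x y h => (Prod.ext_iff.1 h).1
  have hpack : IsPacking U δ ((fun x => (x, r / 2)) '' A) := by
    refine ⟨hcount.image _, ?_, ?_⟩
    · rintro _ ⟨x, hx, rfl⟩
      exact ⟨hA.prop.1 hx, by simpa using hr, by simpa using by linarith⟩
    · rintro _ ⟨x, hx, rfl⟩ _ ⟨y, hy, rfl⟩ hxy
      exact hdisj hx hy fun h => hxy (by rw [h])
  have hμU : μ U / ENNReal.ofReal m ≤ ∑' _ : A, 1 := by
    have := hcount.to_subtype
    refine ENNReal.div_le_of_le_mul ?_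
    calc μ U ≤ μ (⋃ x : A, Metric.closedBall (x : X) r) := by
          refine measure_mono (hcov.trans ?_)
          simp
      _ ≤ ∑' x : A, μ (Metric.closedBall (x : X) r) := measure_iUnion_le _
      _ ≤ ∑' _ : A, 1 * ENNReal.ofReal m := ENNReal.tsum_le_tsum fun x => by
          rw [one_mul]
          refine hμ _ fun y hy z hz => ?_
          linarith [dist_triangle_right y z (x : X), Metric.mem_closedBall.1 hy,
            Metric.mem_closedBall.1 hz]
      _ = _ := ENNReal.tsum_mul_right
  calc μ U / ENNReal.ofReal m * ENNReal.ofReal r ^ s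
      ≤ (∑' _ : A, 1) * ENNReal.ofReal r ^ s := by gcongr
    _ = ∑' p : (fun x => (x, r / 2)) '' A, ENNReal.ofReal (2 * p.1.2) ^ s := by
        rw [tsum_image (f := fun p : X × ℝ => ENNReal.ofReal (2 * p.2) ^ s) hinj.injOn,
          ← ENNReal.tsum_mul_right]
        simp [mul_div_cancel₀]
    _ ≤ packingContent s δ U := le_iSup₂_of_le _ hpack le_rfl

/-- Among countably many sets that cover `F`, one has positive measure, and along the scales
approaching the limsup its packing content is unbounded. -/
theorem IsFrostman.le_dimP [TopologicalSpace.SeparableSpace X] [MeasurableSpace X]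
    (hq0 : q 0 = 1) (hq : ∀ n, 2 * q n ≤ q (n + 1)) (hN : ∀ n, 0 < N n)
    {μ : Measure X} (hμ : IsFrostman q N μ) {F : Set X} (hF : μ F ≠ 0) :
    limsup (fun n => ENNReal.ofReal (Real.log (N (n + 1)) / Real.log (q (n + 1)))) atTop ≤
      dimP F := by
  obtain ⟨M, hM, hμ⟩ := hμ
  have hq1 := one_le_of_two_mul_le hq0 hq
  have hqp : ∀ n, 0 < q n := fun n => zero_lt_one.trans_le (hq1 n)
  have hqtop := tendsto_atTop_of_two_mul_le hq0 hq
  refine ENNReal.le_of_forall_nnreal_lt fun s hs => ?_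
  refine le_iSup₂_of_le s ?_ le_rfl
  obtain ⟨s', hss', hs'⟩ := ENNReal.lt_iff_exists_nnreal_btwn.1 hs
  have hss' : (s : ℝ) < s' := by exact_mod_cast hss'
  refine top_le_iff.1 (le_iInf₂ fun U hU => ?_)
  obtain ⟨i, hi⟩ : ∃ i, μ (U i) ≠ 0 := by
    by_contra! h
    exact hF (measure_mono_null hU (measure_iUnion_null h))
  refine le_trans ?_ (ENNReal.le_tsum i)
  refine le_iInf₂ fun δ hδ => ?_
  -- the packing content of `U i` exceeds a constant times `q n ^ (s' - s)` for infinitely many `n`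
  have hlow : ∀ n, 1 / (2 * q n) ≤ 2 * δ → q n ^ (s' : ℝ) ≤ N n →
      μ (U i) * ENNReal.ofReal (2⁻¹ ^ (s : ℝ) / M * q n ^ ((s' : ℝ) - s)) ≤
        packingContent (s : ℝ) δ (U i) := fun n h1 h2 => by
    have hp := hqp n
    have hNp := hN n
    refine le_trans ?_ (le_packingContent_of_measure_le (r := 1 / (2 * q n)) (by positivity) h1
      (fun V hV => hμ n V fun x hx y hy => (hV x hx y hy).trans_eq ?_) (U i))
    · rw [div_eq_mul_inv (μ (U i)), mul_assoc, ← ENNReal.ofReal_inv_of_pos (by positivity),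
        ENNReal.ofReal_rpow_of_pos (by positivity), ← ENNReal.ofReal_mul (by positivity)]
      refine mul_le_mul' le_rfl (ENNReal.ofReal_le_ofReal ?_)
      rw [one_div, mul_inv, Real.mul_rpow (by positivity) (by positivity), Real.inv_rpow hp.le,
        Real.rpow_sub hp, inv_div]
      have := Real.rpow_pos_of_pos hp (s : ℝ)
      calc _ = 2⁻¹ ^ (s : ℝ) * (q n ^ (s' : ℝ) / M) * (q n ^ (s : ℝ))⁻¹ := by ring
        _ ≤ 2⁻¹ ^ (s : ℝ) * (N n / M) * (q n ^ (s : ℝ))⁻¹ := by gcongr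
        _ = _ := by ring
    · field_simp
  have hlim : Tendsto (fun n => μ (U i) *
      ENNReal.ofReal (2⁻¹ ^ (s : ℝ) / M * q (n + 1) ^ ((s' : ℝ) - s))) atTop (𝓝 ∞) := by
    have h1 : Tendsto (fun n => 2⁻¹ ^ (s : ℝ) / M * q (n + 1) ^ ((s' : ℝ) - s)) atTop atTop :=
      ((tendsto_rpow_atTop (by linarith)).comp
        (hqtop.comp (tendsto_add_atTop_nat 1))).const_mul_atTop (by positivity)
    have h2 := ENNReal.Tendsto.const_mul (a := μ (U i)) (ENNReal.tendsto_ofReal_atTop.comp h1)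
      (Or.inl ENNReal.top_ne_zero)
    rwa [ENNReal.mul_top hi] at h2
  have hfreq := frequently_lt_of_lt_limsup (by isBoundedDefault) hs'
  have hsmall : ∀ᶠ n in atTop, 1 / (2 * q (n + 1)) < 2 * δ := by
    have : Tendsto (fun n => 1 / (2 * q (n + 1))) atTop (𝓝 0) :=
      ((hqtop.comp (tendsto_add_atTop_nat 1)).const_mul_atTop two_pos).const_div_atTop 1
    exact this.eventually_lt_const (by linarith)
  refine le_of_forall_lt fun x hx => ?_
  obtain ⟨n, hn, h1, h2⟩ := (hfreq.and_eventually
    (hsmall.and (hlim.eventually_const_lt hx))).exists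
  exact h2.trans_le (hlow (n + 1) h1.le
    (rpow_le_of_lt_log_ratio (hN _) (by linarith [hq n, hq1 n]) hn))

end Packing

/-! ### Digit expansions -/

section Coding

variable {d : ℕ} {c C : ℕ → ℝ}

/-- The product `C 0 * ⋯ * C (n - 1)` of the first `n` terms; in contrast to `scale`, the empty
product is included. -/
noncomputable def partialScale (C : ℕ → ℝ) (n : ℕ) : ℝ := ∏ i ∈ Finset.range n, C i

lemma partialScale_zero : partialScale C 0 = 1 := by simp [partialScale]

lemma partialScale_succ (n : ℕ) : partialScale C (n + 1) = partialScale C n * C n :=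
  Finset.prod_range_succ _ _

lemma scale_eq_partialScale (n : ℕ) : scale C n = partialScale C (n + 1) := rfl

lemma partialScale_pos (hc : ∀ k, 1 ≤ c k) (hC : ∀ k, c k + 1 ≤ C k) (n : ℕ) :
    0 < partialScale C n :=
  Finset.prod_pos fun k _ => by linarith [hc k, hC k]

lemma two_mul_partialScale_le (hc : ∀ k, 1 ≤ c k) (hC : ∀ k, c k + 1 ≤ C k) (n : ℕ) :
    2 * partialScale C n ≤ partialScale C (n + 1) := by
  rw [partialScale_succ]
  nlinarith [partialScale_pos hc hC n, hc n, hC n]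

/-- The partial sum of the first `n` terms of `∑ (C 0 ⋯ C k)⁻¹ f k`. -/
noncomputable def digitPartialSum (C : ℕ → ℝ) (f : ℕ → EuclideanSpace ℝ (Fin d)) (n : ℕ) :
    EuclideanSpace ℝ (Fin d) :=
  ∑ k ∈ Finset.range n, (scale C k)⁻¹ • f k

lemma digitPartialSum_succ (f : ℕ → EuclideanSpace ℝ (Fin d)) (n : ℕ) :
    digitPartialSum C f (n + 1) = digitPartialSum C f n + (scale C n)⁻¹ • f n :=
  Finset.sum_range_succ _ _

lemma digitPartialSum_succ_apply (f : ℕ → EuclideanSpace ℝ (Fin d)) (n : ℕ) (i : Fin d) :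
    digitPartialSum C f (n + 1) i = digitPartialSum C f n i + (scale C n)⁻¹ * f n i := by
  rw [digitPartialSum_succ]; simp

lemma mem_digitSum_iff {F : ℕ → Set (EuclideanSpace ℝ (Fin d))} {x : EuclideanSpace ℝ (Fin d)} :
    x ∈ digitSum C F ↔
      ∃ f : ℕ → EuclideanSpace ℝ (Fin d), (∀ k, f k ∈ F k) ∧
        Tendsto (digitPartialSum C f) atTop (𝓝 x) := by
  constructor
  · rintro ⟨a, ha, hlim⟩
    choose f hf hfa using fun k => Set.mem_smul_set.1 (ha k)
    refine ⟨f, hf, ?_⟩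
    convert hlim using 2 with n
    exact Finset.sum_congr rfl fun k _ => hfa k
  · rintro ⟨f, hf, hlim⟩
    exact ⟨fun k => (scale C k)⁻¹ • f k, fun k => Set.smul_mem_smul_set (hf k), hlim⟩

lemma digitSum_mono {F G : ℕ → Set (EuclideanSpace ℝ (Fin d))} (h : ∀ k, F k ⊆ G k) :
    digitSum C F ⊆ digitSum C G := fun _ hx => by
  obtain ⟨f, hf, hlim⟩ := mem_digitSum_iff.1 hx
  exact mem_digitSum_iff.2 ⟨f, fun k => h k (hf k), hlim⟩

lemma inv_scale_mul_le (hc : ∀ k, 1 ≤ c k) (hC : ∀ k, c k + 1 ≤ C k) (n : ℕ) :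
    (scale C n)⁻¹ * c n ≤ 1 / partialScale C n - 1 / partialScale C (n + 1) := by
  have h1 := partialScale_pos hc hC n
  have h2 : 0 < C n := by linarith [hc n, hC n]
  rw [scale_eq_partialScale, partialScale_succ, div_sub_div _ _ h1.ne' (by positivity),
    inv_mul_eq_div, div_le_div_iff₀ (by positivity) (by positivity)]
  have h3 : 0 ≤ partialScale C n * C n * partialScale C n * (C n - 1 - c n) := by
    have : 0 ≤ C n - 1 - c n := by linarith [hC n]
    positivity
  linarith

/-- Digits bounded by `c k` contribute at most a telescoping amount, because `c k ≤ C k - 1`. -/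
lemma digitPartialSum_sub_mem (hc : ∀ k, 1 ≤ c k) (hC : ∀ k, c k + 1 ≤ C k)
    {f : ℕ → EuclideanSpace ℝ (Fin d)} {n m : ℕ} (hnm : n ≤ m)
    (hf : ∀ k, n ≤ k → k < m → f k ∈ cube d (c k)) (i : Fin d) :
    0 ≤ digitPartialSum C f m i - digitPartialSum C f n i ∧
      digitPartialSum C f m i - digitPartialSum C f n i ≤
        1 / partialScale C n - 1 / partialScale C m := by
  induction m, hnm using Nat.le_induction with
  | base => simp
  | succ m hnm ih =>
    obtain ⟨ih1, ih2⟩ := ih fun k h1 h2 => hf k h1 (by omega)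
    obtain ⟨h1, h2⟩ := hf m hnm (by omega) i
    have hp : 0 < (scale C m)⁻¹ := inv_pos.2 (partialScale_pos hc hC (m + 1))
    have h3 := inv_scale_mul_le hc hC m
    have h4 := mul_le_mul_of_nonneg_left h2 hp.le
    have h5 := mul_nonneg hp.le h1
    rw [digitPartialSum_succ_apply]
    constructor <;> linarith

/-- Different words of integral digits have partial sums that are `1 / partialScale C n`-separated
in the maximum norm. -/
lemma digitPartialSum_separated (hc : ∀ k, 1 ≤ c k) (hC : ∀ k, c k + 1 ≤ C k)
    {f g : ℕ → EuclideanSpace ℝ (Fin d)} {n : ℕ}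
    (hf : ∀ k < n, f k ∈ cube d (c k) ∩ intLattice d)
    (hg : ∀ k < n, g k ∈ cube d (c k) ∩ intLattice d) (hne : ∃ k < n, f k ≠ g k) :
    ∃ i, 1 / partialScale C n ≤ |digitPartialSum C f n i - digitPartialSum C g n i| := by
  classical
  -- the first place at which the words differ
  let j := Nat.find hne
  obtain ⟨hjn, hj⟩ : j < n ∧ f j ≠ g j := Nat.find_spec hne
  have hpre : digitPartialSum C f j = digitPartialSum C g j :=
    Finset.sum_congr rfl fun k hk => by
      have hk := Finset.mem_range.1 hk
      have : f k = g k := by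
        by_contra h
        exact Nat.find_min hne hk ⟨hk.trans hjn, h⟩
      rw [this]
  obtain ⟨i, hi⟩ : ∃ i, f j i ≠ g j i := by
    by_contra! h
    exact hj (by ext i; exact h i)
  have hint : 1 ≤ |f j i - g j i| := by
    obtain ⟨a, ha⟩ := (hf j hjn).2 i
    obtain ⟨b, hb⟩ := (hg j hjn).2 i
    rw [ha, hb] at hi ⊢
    have hab : a - b ≠ 0 := fun h => hi (by rw [sub_eq_zero.1 h])
    have : (1 : ℝ) ≤ ((|a - b| : ℤ) : ℝ) := by exact_mod_cast Int.one_le_abs hab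
    rwa [Int.cast_abs, Int.cast_sub] at this
  have hp : 0 < (scale C j)⁻¹ := inv_pos.2 (partialScale_pos hc hC (j + 1))
  obtain ⟨hf1, hf2⟩ := digitPartialSum_sub_mem hc hC hjn (fun k _ h => (hf k h).1) i
  obtain ⟨hg1, hg2⟩ := digitPartialSum_sub_mem hc hC hjn (fun k _ h => (hg k h).1) i
  have hf3 := digitPartialSum_succ_apply (C := C) f j i
  have hg3 := digitPartialSum_succ_apply (C := C) g j i
  rw [hpre] at hf3
  have hs : (scale C j)⁻¹ = 1 / partialScale C (j + 1) := by rw [one_div]; rfl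
  refine ⟨i, ?_⟩
  have h1 : 1 / partialScale C (j + 1) ≤ |(scale C j)⁻¹ * f j i - (scale C j)⁻¹ * g j i| := by
    rw [← mul_sub, abs_mul, abs_of_pos hp, ← hs]
    nlinarith
  rcases le_total ((scale C j)⁻¹ * f j i) ((scale C j)⁻¹ * g j i) with h | h
  · rw [abs_of_nonpos (by linarith)] at h1
    rw [abs_sub_comm]
    exact le_trans (by linarith) (le_abs_self _)
  · rw [abs_of_nonneg (by linarith)] at h1
    exact le_trans (by linarith) (le_abs_self _)

/-- The axis-parallel cube with smallest vertex `p` and side length `h`. -/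
def box (p : EuclideanSpace ℝ (Fin d)) (h : ℝ) : Set (EuclideanSpace ℝ (Fin d)) :=
  {x | ∀ i, p i ≤ x i ∧ x i ≤ p i + h}

lemma norm_le_sqrt_mul {x : EuclideanSpace ℝ (Fin d)} {h : ℝ} (hh : 0 ≤ h)
    (hx : ∀ i, |x i| ≤ h) : ‖x‖ ≤ √d * h := by
  rw [EuclideanSpace.norm_eq, ← Real.sqrt_sq hh, ← Real.sqrt_mul (by positivity)]
  refine Real.sqrt_le_sqrt ?_
  calc ∑ i, ‖x i‖ ^ 2 ≤ ∑ _ : Fin d, h ^ 2 := by gcongr with i; exact hx i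
    _ = d * h ^ 2 := by simp

lemma dist_le_of_mem_box {p x y : EuclideanSpace ℝ (Fin d)} {h : ℝ} (hh : 0 ≤ h)
    (hx : x ∈ box p h) (hy : y ∈ box p h) : dist x y ≤ √d * h := by
  rw [dist_eq_norm]
  refine norm_le_sqrt_mul hh fun i => ?_
  rw [PiLp.sub_apply, abs_le]
  constructor <;> linarith [hx i, hy i]

lemma volume_box_le (p : EuclideanSpace ℝ (Fin d)) {h : ℝ} (hh : 0 ≤ h) :
    volume (box p h) ≤ ENNReal.ofReal (h ^ d) := by
  have hbox : box p h = WithLp.ofLp ⁻¹' Set.Icc (p.ofLp) (fun i => p i + h) := by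
    ext x
    simp [box, Pi.le_def, forall_and]
  rw [hbox, (PiLp.volume_preserving_ofLp (Fin d)).measure_preimage
    measurableSet_Icc.nullMeasurableSet,
    Real.volume_Icc_pi, ENNReal.ofReal_pow hh]
  simp

lemma tendsto_apply {ι : Type*} {l : Filter ι} {u : ι → EuclideanSpace ℝ (Fin d)}
    {x : EuclideanSpace ℝ (Fin d)} (h : Tendsto u l (𝓝 x)) (i : Fin d) :
    Tendsto (fun n => u n i) l (𝓝 (x i)) :=
  ((EuclideanSpace.proj (𝕜 := ℝ) i).continuous.tendsto x).comp h

/-- If the digits from `n` on lie in the cubes, the sum lies in the box at the `n`-th partial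
sum. -/
lemma mem_box_of_tendsto (hc : ∀ k, 1 ≤ c k) (hC : ∀ k, c k + 1 ≤ C k)
    {f : ℕ → EuclideanSpace ℝ (Fin d)} {n : ℕ} (hf : ∀ k, n ≤ k → f k ∈ cube d (c k))
    {x : EuclideanSpace ℝ (Fin d)} (hx : Tendsto (digitPartialSum C f) atTop (𝓝 x)) :
    x ∈ box (digitPartialSum C f n) (1 / partialScale C n) := fun i => by
  have hlim := tendsto_apply hx i
  have hev := (eventually_ge_atTop n).mono fun m hm =>
    digitPartialSum_sub_mem hc hC hm (fun k h _ => hf k h) i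
  refine ⟨ge_of_tendsto hlim (hev.mono fun m hm => by linarith [hm.1]),
    le_of_tendsto hlim (hev.mono fun m hm => ?_)⟩
  have : 0 < 1 / partialScale C m := one_div_pos.2 (partialScale_pos hc hC m)
  linarith [hm.2]

/-- The partial sums of length `n` take at most as many values as there are words. -/
lemma exists_finset_digitPartialSum_mem (C : ℕ → ℝ) {F : ℕ → Set (EuclideanSpace ℝ (Fin d))}
    (hF : ∀ k, (F k).Finite) (n : ℕ) :
    ∃ T : Finset (EuclideanSpace ℝ (Fin d)), T.card ≤ ∏ k ∈ Finset.range n, (F k).ncard ∧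
      ∀ f : ℕ → EuclideanSpace ℝ (Fin d), (∀ k, f k ∈ F k) → digitPartialSum C f n ∈ T := by
  classical
  induction n with
  | zero => exact ⟨{0}, by simp, fun f _ => by simp [digitPartialSum]⟩
  | succ n ih =>
    obtain ⟨T, hT, hmem⟩ := ih
    refine ⟨Finset.image₂ (fun x y => x + (scale C n)⁻¹ • y) T (hF n).toFinset, ?_, fun f hf => ?_⟩
    · refine (Finset.card_image₂_le _ _ _).trans ?_
      rw [Finset.prod_range_succ, Set.ncard_eq_toFinset_card _ (hF n)]
      gcongr
    · rw [digitPartialSum_succ]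
      exact Finset.mem_image₂_of_mem (hmem f hf) ((hF n).mem_toFinset.2 (hf n))

/-- The set of sums over digit sets that lie in the cubes from `K` on is covered at each scale by
boxes, one for each word. -/
lemma exists_box_cover (hc : ∀ k, 1 ≤ c k) (hC : ∀ k, c k + 1 ≤ C k)
    {F : ℕ → Set (EuclideanSpace ℝ (Fin d))} (hF : ∀ k, (F k).Finite) {n : ℕ}
    (hcube : ∀ k, n ≤ k → F k ⊆ cube d (c k)) :
    ∃ T : Finset (EuclideanSpace ℝ (Fin d)), T.card ≤ ∏ k ∈ Finset.range n, (F k).ncard ∧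
      digitSum C F ⊆ ⋃ p ∈ T, box p (1 / partialScale C n) := by
  obtain ⟨T, hT, hmem⟩ := exists_finset_digitPartialSum_mem C hF n
  refine ⟨T, hT, fun x hx => ?_⟩
  obtain ⟨f, hf, hlim⟩ := mem_digitSum_iff.1 hx
  exact Set.mem_biUnion (hmem f hf) (mem_box_of_tendsto hc hC (fun k hk => hcube k hk (hf k)) hlim)

/-- The sum of the series whose digits are given by a point of the product of the digit sets. -/
noncomputable def digitMap (C : ℕ → ℝ) (F : ℕ → Set (EuclideanSpace ℝ (Fin d))) (ω : ∀ k, F k) :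
    EuclideanSpace ℝ (Fin d) :=
  ∑' k, (scale C k)⁻¹ • (ω k : EuclideanSpace ℝ (Fin d))

lemma exists_summable_bound (hc : ∀ k, 1 ≤ c k) (hC : ∀ k, c k + 1 ≤ C k)
    {F : ℕ → Set (EuclideanSpace ℝ (Fin d))} (hF : ∀ k, (F k).Finite) {K : ℕ}
    (hcube : ∀ k, K ≤ k → F k ⊆ cube d (c k)) :
    ∃ u : ℕ → ℝ, Summable u ∧ ∀ k, ∀ x ∈ F k, ‖(scale C k)⁻¹ • x‖ ≤ u k := by
  choose v hv using fun k => ((hF k).image fun x => ‖(scale C k)⁻¹ • x‖).bddAbove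
  refine ⟨fun k => if k < K then v k else √d * (1 / 2) ^ k, ?_, fun k x hx => ?_⟩
  · rw [← summable_nat_add_iff K]
    have : ∀ k, ¬ k + K < K := fun k => by omega
    simp only [this, if_false]
    exact (summable_nat_add_iff K).2 (summable_geometric_two.mul_left _)
  · dsimp only
    split_ifs with h
    · exact hv k ⟨x, hx, rfl⟩
    · have hp : 0 < (scale C k)⁻¹ := inv_pos.2 (partialScale_pos hc hC (k + 1))
      refine norm_le_sqrt_mul (by positivity) fun i => ?_
      obtain ⟨h1, h2⟩ := hcube k (not_lt.1 h) hx i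
      rw [PiLp.smul_apply, smul_eq_mul, abs_of_nonneg (by positivity)]
      calc (scale C k)⁻¹ * x i ≤ (scale C k)⁻¹ * c k := by gcongr
        _ ≤ 1 / partialScale C k - 1 / partialScale C (k + 1) := inv_scale_mul_le hc hC k
        _ ≤ 1 / partialScale C k := by
          have := one_div_pos.2 (partialScale_pos hc hC (k + 1)); linarith
        _ ≤ (1 / 2) ^ k := by
          rw [one_div_pow]
          exact one_div_le_one_div_of_le (by positivity)
            (two_pow_le_of_two_mul_le partialScale_zero (two_mul_partialScale_le hc hC) k)

lemma tendsto_digitPartialSum_digitMap (hc : ∀ k, 1 ≤ c k) (hC : ∀ k, c k + 1 ≤ C k)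
    {F : ℕ → Set (EuclideanSpace ℝ (Fin d))} (hF : ∀ k, (F k).Finite) {K : ℕ}
    (hcube : ∀ k, K ≤ k → F k ⊆ cube d (c k)) (ω : ∀ k, F k) :
    Tendsto (digitPartialSum C fun k => (ω k : EuclideanSpace ℝ (Fin d))) atTop
      (𝓝 (digitMap C F ω)) := by
  obtain ⟨u, hu, hle⟩ := exists_summable_bound hc hC hF hcube
  exact (Summable.of_norm_bounded hu fun k => hle k _ (ω k).2).hasSum.tendsto_sum_nat

lemma continuous_digitMap (hc : ∀ k, 1 ≤ c k) (hC : ∀ k, c k + 1 ≤ C k)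
    {F : ℕ → Set (EuclideanSpace ℝ (Fin d))} (hF : ∀ k, (F k).Finite) {K : ℕ}
    (hcube : ∀ k, K ≤ k → F k ⊆ cube d (c k)) : Continuous (digitMap C F) := by
  obtain ⟨u, hu, hle⟩ := exists_summable_bound hc hC hF hcube
  exact continuous_tsum (fun k => by fun_prop) hu fun k ω => hle k _ (ω k).2

lemma isCompact_digitSum (hc : ∀ k, 1 ≤ c k) (hC : ∀ k, c k + 1 ≤ C k)
    {F : ℕ → Set (EuclideanSpace ℝ (Fin d))} (hF : ∀ k, (F k).Finite) {K : ℕ}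
    (hcube : ∀ k, K ≤ k → F k ⊆ cube d (c k)) : IsCompact (digitSum C F) := by
  have hrange : digitSum C F = Set.range (digitMap C F) := by
    ext x
    rw [mem_digitSum_iff]
    constructor
    · rintro ⟨f, hf, hlim⟩
      exact ⟨fun k => ⟨f k, hf k⟩, tendsto_nhds_unique
        (tendsto_digitPartialSum_digitMap hc hC hF hcube fun k => ⟨f k, hf k⟩) hlim⟩
    · rintro ⟨ω, rfl⟩
      exact ⟨fun k => ω k, fun k => (ω k).2, tendsto_digitPartialSum_digitMap hc hC hF hcube ω⟩
  have := fun k => (hF k).to_subtype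
  rw [hrange]
  exact isCompact_range (continuous_digitMap hc hC hF hcube)

end Coding

/-! ### The uniform measure on a digit sum -/

section UniformMeasure

variable {d : ℕ} {c C : ℕ → ℝ}

/-- The image under `digitMap` of the product of the uniform measures on the digit sets. -/
noncomputable def digitMeasure (C : ℕ → ℝ) (F : ℕ → Set (EuclideanSpace ℝ (Fin d)))
    [∀ k, Fintype (F k)] [∀ k, Nonempty (F k)] : Measure (EuclideanSpace ℝ (Fin d)) :=
  (Measure.infinitePi fun k => (PMF.uniformOfFintype (F k)).toMeasure).map (digitMap C F)

/-- At most `5 ^ d` words of length `n` have their partial sums near a given point: multiplied by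
`partialScale C n` and rounded down, the partial sums of different words are different points of
`ℤ^d`. -/
lemma infinitePi_uniform_near_le (hc : ∀ k, 1 ≤ c k) (hC : ∀ k, c k + 1 ≤ C k)
    {F : ℕ → Set (EuclideanSpace ℝ (Fin d))} [∀ k, Fintype (F k)] [∀ k, Nonempty (F k)]
    (hcube : ∀ k, F k ⊆ cube d (c k)) (hint : ∀ k, F k ⊆ intLattice d) (n : ℕ)
    (x : EuclideanSpace ℝ (Fin d)) :
    (Measure.infinitePi fun k => (PMF.uniformOfFintype (F k)).toMeasure)
        {ω : ∀ k, F k | ∀ i, |digitPartialSum C (fun k => (ω k : EuclideanSpace ℝ (Fin d))) n i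
          - x i| ≤ 2 / partialScale C n} ≤
      ENNReal.ofReal (5 ^ d / ∏ k ∈ Finset.range n, ((F k).ncard : ℝ)) := by
  set ν := Measure.infinitePi fun k => (PMF.uniformOfFintype (F k)).toMeasure
  have hq := partialScale_pos hc hC n
  let p : (∀ k, F k) → EuclideanSpace ℝ (Fin d) := fun ω =>
    digitPartialSum C (fun k => (ω k : EuclideanSpace ℝ (Fin d))) n
  let code : (∀ k, F k) → Fin d → ℤ := fun ω i => ⌊p ω i * partialScale C n⌋
  let Z : Finset (Fin d → ℤ) := Fintype.piFinset fun i =>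
    Finset.Icc (⌊x i * partialScale C n⌋ - 2) (⌊x i * partialScale C n⌋ + 2)
  have hZ : (Z.card : ℝ≥0∞) = 5 ^ d := by
    have h5 : ∀ a : ℤ, (a + 2 + 1 - (a - 2)).toNat = 5 := fun a => by omega
    simp [Z, Fintype.card_piFinset, h5]
  have hfiber : ∀ z, ν {ω | code ω = z} ≤
      ENNReal.ofReal (1 / ∏ k ∈ Finset.range n, ((F k).ncard : ℝ)) := fun z => by
    rcases Set.eq_empty_or_nonempty {ω | code ω = z} with h | ⟨ω₀, h₀⟩
    · simp [h]
    have hsub : {ω | code ω = z} ⊆ Set.pi (Finset.range n) fun k => {ω₀ k} := by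
      intro ω hω k hk
      have hk := Finset.mem_range.1 (Finset.mem_coe.1 hk)
      by_contra hne
      obtain ⟨i, hi⟩ := digitPartialSum_separated hc hC (n := n)
        (f := fun k => (ω k : EuclideanSpace ℝ (Fin d)))
        (g := fun k => (ω₀ k : EuclideanSpace ℝ (Fin d)))
        (fun k _ => ⟨hcube k (ω k).2, hint k (ω k).2⟩)
        (fun k _ => ⟨hcube k (ω₀ k).2, hint k (ω₀ k).2⟩)
        ⟨k, hk, fun h => hne (Subtype.ext h)⟩
      have hcode : ⌊p ω i * partialScale C n⌋ = ⌊p ω₀ i * partialScale C n⌋ :=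
        congrFun (hω.trans h₀.symm) i
      have := Int.abs_sub_lt_one_of_floor_eq_floor hcode
      rw [← sub_mul, abs_mul, abs_of_pos hq] at this
      rw [div_le_iff₀ hq] at hi
      exact absurd hi (not_le.2 this)
    refine (measure_mono hsub).trans ?_
    rw [Measure.infinitePi_pi _ fun k _ => measurableSet_singleton _, one_div,
      ← Finset.prod_inv_distrib, ENNReal.ofReal_prod_of_nonneg fun k _ => by positivity]
    refine Finset.prod_le_prod' fun k _ => ?_
    have hpos : 0 < Fintype.card (F k) := Fintype.card_pos
    rw [PMF.toMeasure_apply_singleton _ _ (measurableSet_singleton _), PMF.uniformOfFintype_apply,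
      Set.ncard_eq_toFinset_card', Set.toFinset_card,
      ENNReal.ofReal_inv_of_pos (by exact_mod_cast hpos), ENNReal.ofReal_natCast]
  have hcov : {ω : ∀ k, F k | ∀ i, |p ω i - x i| ≤ 2 / partialScale C n} ⊆
      ⋃ z ∈ Z, {ω | code ω = z} := by
    intro ω hω
    refine Set.mem_biUnion (x := code ω) (Finset.mem_coe.2 (Fintype.mem_piFinset.2 fun i => ?_)) rfl
    have h := hω i
    rw [le_div_iff₀ hq, ← abs_of_pos hq, ← abs_mul, sub_mul, abs_le] at h
    rw [Finset.mem_Icc, ← Int.floor_sub_ofNat, ← Int.floor_add_ofNat]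
    exact ⟨Int.floor_le_floor (by linarith), Int.floor_le_floor (by linarith)⟩
  calc _ ≤ ν (⋃ z ∈ Z, {ω | code ω = z}) := measure_mono hcov
    _ ≤ ∑ z ∈ Z, ν {ω | code ω = z} := measure_biUnion_finset_le _ _
    _ ≤ ∑ _ ∈ Z, ENNReal.ofReal (1 / ∏ k ∈ Finset.range n, ((F k).ncard : ℝ)) := by
      gcongr with z; exact hfiber z
    _ = ENNReal.ofReal (5 ^ d / ∏ k ∈ Finset.range n, ((F k).ncard : ℝ)) := by
      rw [Finset.sum_const, nsmul_eq_mul, hZ, div_eq_mul_one_div (5 ^ d : ℝ),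
        ENNReal.ofReal_mul (by positivity), ENNReal.ofReal_pow (by norm_num)]
      simp

/-- A point and its partial sum of length `n` differ by at most `1 / partialScale C n`, so a set of
that diameter meets the sums of at most `5 ^ d` words. -/
theorem isFrostman_digitMeasure (hc : ∀ k, 1 ≤ c k) (hC : ∀ k, c k + 1 ≤ C k)
    {F : ℕ → Set (EuclideanSpace ℝ (Fin d))} [∀ k, Fintype (F k)] [∀ k, Nonempty (F k)]
    (hcube : ∀ k, F k ⊆ cube d (c k)) (hint : ∀ k, F k ⊆ intLattice d) :
    IsFrostman (partialScale C) (fun n => ∏ k ∈ Finset.range n, ((F k).ncard : ℝ))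
      (digitMeasure C F) := by
  refine ⟨5 ^ d, by positivity, fun n U hU => ?_⟩
  rcases U.eq_empty_or_nonempty with rfl | ⟨x, hx⟩
  · simp
  have hq := partialScale_pos hc hC n
  have hfin := fun k => (F k).toFinite
  have hcont : Continuous (digitMap C F) :=
    continuous_digitMap hc hC hfin (K := 0) fun k _ => hcube k
  refine le_trans ?_ (infinitePi_uniform_near_le hc hC hcube hint n x)
  have hsub : U ⊆ Metric.closedBall x (1 / partialScale C n) := fun y hy =>
    Metric.mem_closedBall.2 (hU y hy x hx)
  refine (measure_mono hsub).trans ?_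
  rw [digitMeasure, Measure.map_apply hcont.measurable Metric.isClosed_closedBall.measurableSet]
  refine measure_mono fun ω hω i => ?_
  have h1 := mem_box_of_tendsto hc hC (n := n) (fun k _ => hcube k (ω k).2)
    (tendsto_digitPartialSum_digitMap hc hC hfin (K := 0) (fun k _ => hcube k) ω) i
  have h2 : |digitMap C F ω i - x i| ≤ 1 / partialScale C n := by
    have := Metric.mem_closedBall.1 hω
    rw [dist_eq_norm] at this
    exact (PiLp.norm_apply_le (digitMap C F ω - x) i).trans this
  rw [abs_le] at h2 ⊢
  have h3 : 2 / partialScale C n = 1 / partialScale C n + 1 / partialScale C n := by ring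
  have : 0 < 1 / partialScale C n := by positivity
  constructor <;> linarith [h1.1, h1.2, h2.1, h2.2]

theorem digitMeasure_digitSum_ne_zero (hc : ∀ k, 1 ≤ c k) (hC : ∀ k, c k + 1 ≤ C k)
    {F : ℕ → Set (EuclideanSpace ℝ (Fin d))} [∀ k, Fintype (F k)] [∀ k, Nonempty (F k)]
    (hcube : ∀ k, F k ⊆ cube d (c k)) : digitMeasure C F (digitSum C F) ≠ 0 := by
  have hfin := fun k => (F k).toFinite
  have hcont : Continuous (digitMap C F) :=
    continuous_digitMap hc hC hfin (K := 0) fun k _ => hcube k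
  have hpre : digitMap C F ⁻¹' digitSum C F = Set.univ := Set.eq_univ_of_forall fun ω =>
    mem_digitSum_iff.2 ⟨fun k => ω k, fun k => (ω k).2,
      tendsto_digitPartialSum_digitMap hc hC hfin (K := 0) (fun k _ => hcube k) ω⟩
  rw [digitMeasure, Measure.map_apply hcont.measurable
    (isCompact_digitSum hc hC hfin (K := 0) fun k _ => hcube k).isClosed.measurableSet, hpre]
  simp

end UniformMeasure

/-! ### Sets of sums with near digits from some place on -/

section NearDigits

variable {d : ℕ} {c C : ℕ → ℝ} {B : ℕ → Set (EuclideanSpace ℝ (Fin d))}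

/-- The digit sets `B k` for `k < K` and `B k ∩ [0, c k]^d` for `k ≥ K`. -/
def nearFrom (c : ℕ → ℝ) (B : ℕ → Set (EuclideanSpace ℝ (Fin d))) (K k : ℕ) :
    Set (EuclideanSpace ℝ (Fin d)) :=
  if k < K then B k else B k ∩ cube d (c k)

lemma nearFrom_of_le {K k : ℕ} (h : K ≤ k) : nearFrom c B K k = B k ∩ cube d (c k) :=
  if_neg (not_lt.2 h)

lemma nearFrom_subset (K k : ℕ) : nearFrom c B K k ⊆ B k := by
  unfold nearFrom
  split_ifs
  · exact subset_rfl
  · exact Set.inter_subset_left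

lemma mem_nearFrom {K k : ℕ} {x : EuclideanSpace ℝ (Fin d)} (hx : x ∈ B k)
    (h : K ≤ k → x ∈ cube d (c k)) : x ∈ nearFrom c B K k := by
  unfold nearFrom
  split_ifs with hk
  · exact hx
  · exact ⟨hx, h (not_lt.1 hk)⟩

lemma nearFrom_subset_cube {K : ℕ} (k : ℕ) (h : K ≤ k) : nearFrom c B K k ⊆ cube d (c k) := by
  rw [nearFrom_of_le h]
  exact Set.inter_subset_right

lemma digitSum_nearFrom_subset (K : ℕ) : digitSum C (nearFrom c B K) ⊆ digitSum C B :=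
  digitSum_mono (nearFrom_subset K)

lemma finite_nearFrom (hfin : ∀ k, (B k).Finite) (K k : ℕ) : (nearFrom c B K k).Finite :=
  (hfin k).subset (nearFrom_subset K k)

/-- The product of the numbers of near digits at the first `n` places. -/
noncomputable def wordCount (c : ℕ → ℝ) (B : ℕ → Set (EuclideanSpace ℝ (Fin d))) (n : ℕ) : ℝ :=
  ∏ k ∈ Finset.range n, (nearCard c B k : ℝ)

lemma nearCard_pos (hfin : ∀ k, (B k).Finite) (hne : ∀ k, (B k ∩ cube d (c k)).Nonempty) (k : ℕ) :
    0 < nearCard c B k :=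
  (Set.ncard_pos ((hfin k).inter_of_left _)).2 (hne k)

lemma wordCount_pos (hfin : ∀ k, (B k).Finite) (hne : ∀ k, (B k ∩ cube d (c k)).Nonempty)
    (n : ℕ) : 0 < wordCount c B n :=
  Finset.prod_pos fun k _ => Nat.cast_pos.2 (nearCard_pos hfin hne k)

/-- Admitting all digits at the first `K` places increases the number of words by at most a
constant factor. -/
lemma exists_card_nearFrom_le (hfin : ∀ k, (B k).Finite)
    (hne : ∀ k, (B k ∩ cube d (c k)).Nonempty) (K : ℕ) :
    ∃ A : ℝ, 0 ≤ A ∧ ∀ n, K ≤ n →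
      ((∏ k ∈ Finset.range n, (nearFrom c B K k).ncard : ℕ) : ℝ) ≤ A * wordCount c B n := by
  refine ⟨∏ k ∈ Finset.range K, ((nearFrom c B K k).ncard : ℝ), by positivity, fun n hn => ?_⟩
  have h1 : ∀ k ∈ Finset.Ico K n, ((nearFrom c B K k).ncard : ℝ) = nearCard c B k := fun k hk => by
    rw [nearFrom_of_le (Finset.mem_Ico.1 hk).1]; rfl
  have h2 : 1 ≤ ∏ k ∈ Finset.range K, (nearCard c B k : ℝ) :=
    mod_cast Finset.one_le_prod' fun k _ => nearCard_pos hfin hne k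
  push_cast
  rw [wordCount, ← Finset.prod_range_mul_prod_Ico _ hn, ← Finset.prod_range_mul_prod_Ico _ hn,
    Finset.prod_congr rfl h1]
  gcongr
  exact le_mul_of_one_le_left (by positivity) h2

/-- The digit sums with near digits from place `K` on are covered, at each scale `n ≥ K`, by a
constant times `wordCount c B n` boxes. -/
lemma exists_box_cover_nearFrom (hc : ∀ k, 1 ≤ c k) (hC : ∀ k, c k + 1 ≤ C k)
    (hfin : ∀ k, (B k).Finite) (hne : ∀ k, (B k ∩ cube d (c k)).Nonempty) (K : ℕ) :
    ∃ A : ℝ, 0 ≤ A ∧ ∀ n, K ≤ n → ∃ T : Finset (EuclideanSpace ℝ (Fin d)),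
      (T.card : ℝ) ≤ A * wordCount c B n ∧
        digitSum C (nearFrom c B K) ⊆ ⋃ p ∈ T, box p (1 / partialScale C n) := by
  obtain ⟨A, hA, hle⟩ := exists_card_nearFrom_le hfin hne K
  refine ⟨A, hA, fun n hn => ?_⟩
  obtain ⟨T, hT, hcov⟩ := exists_box_cover hc hC (finite_nearFrom (c := c) hfin K) (n := n)
    fun k hk => nearFrom_subset_cube k (hn.trans hk)
  exact ⟨T, le_trans (by exact_mod_cast hT) (hle n hn), hcov⟩

lemma isCoveredAtScales_nearFrom (hd : 1 ≤ d) (hc : ∀ k, 1 ≤ c k) (hC : ∀ k, c k + 1 ≤ C k)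
    (hfin : ∀ k, (B k).Finite) (hne : ∀ k, (B k ∩ cube d (c k)).Nonempty) (K : ℕ) :
    IsCoveredAtScales (partialScale C) (wordCount c B) (digitSum C (nearFrom c B K)) := by
  classical
  obtain ⟨A, hA, hcov⟩ := exists_box_cover_nearFrom hc hC hfin hne K
  refine ⟨A, √d, hA, Real.sqrt_pos.2 (by exact_mod_cast hd),
    (eventually_ge_atTop K).mono fun n hn => ?_⟩
  obtain ⟨T, hT, hsub⟩ := hcov n hn
  refine ⟨T.image fun p => box p (1 / partialScale C n), ?_, ?_, ?_⟩
  · exact le_trans (by exact_mod_cast Finset.card_image_le) hT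
  · intro U hU x hx y hy
    obtain ⟨p, -, rfl⟩ := Finset.mem_image.1 hU
    rw [div_eq_mul_one_div]
    exact dist_le_of_mem_box (one_div_nonneg.2 (partialScale_pos hc hC n).le) hx hy
  · simpa using hsub

theorem volume_digitSum_nearFrom_eq_zero (hc : ∀ k, 1 ≤ c k) (hC : ∀ k, c k + 1 ≤ C k)
    (hfin : ∀ k, (B k).Finite) (hne : ∀ k, (B k ∩ cube d (c k)).Nonempty)
    (hlim : Tendsto (fun n => ∏ k ∈ Finset.range n, (nearCard c B k : ℝ) / C k ^ d) atTop (𝓝 0))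
    (K : ℕ) : volume (digitSum C (nearFrom c B K)) = 0 := by
  obtain ⟨A, hA, hcov⟩ := exists_box_cover_nearFrom hc hC hfin hne K
  have hlim' := ENNReal.tendsto_ofReal (hlim.const_mul A)
  rw [mul_zero, ENNReal.ofReal_zero] at hlim'
  refine le_antisymm (ge_of_tendsto hlim' ((eventually_ge_atTop K).mono fun n hn => ?_)) zero_le
  obtain ⟨T, hT, hsub⟩ := hcov n hn
  have hq := partialScale_pos hc hC n
  calc volume (digitSum C (nearFrom c B K))
      ≤ volume (⋃ p ∈ T, box p (1 / partialScale C n)) := measure_mono hsub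
    _ ≤ ∑ p ∈ T, volume (box p (1 / partialScale C n)) := measure_biUnion_finset_le _ _
    _ ≤ ∑ _ ∈ T, ENNReal.ofReal ((1 / partialScale C n) ^ d) := by
      gcongr with p; exact volume_box_le p (by positivity)
    _ = ENNReal.ofReal (T.card * (1 / partialScale C n) ^ d) := by
      rw [ENNReal.ofReal_mul (by positivity), ENNReal.ofReal_natCast]; simp
    _ ≤ ENNReal.ofReal (A * wordCount c B n * (1 / partialScale C n) ^ d) := by gcongr
    _ = _ := by
      rw [Finset.prod_div_distrib, Finset.prod_pow, wordCount, partialScale, one_div_pow]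
      ring_nf

lemma scaledFar_le {k : ℕ} {x : EuclideanSpace ℝ (Fin d)} (hx : x ∈ B k) (hx' : x ∉ cube d (c k)) :
    scaledFar c C B k ≤ ‖(((scale C k)⁻¹ • x).ofLp : Fin d → ℝ)‖ₑ := by
  rw [WithLp.ofLp_smul, enorm_smul]
  refine mul_le_mul' ?_ (iInf₂_le x ⟨hx, hx'⟩)
  rw [Real.enorm_eq_ofReal_abs]
  exact ENNReal.ofReal_le_ofReal (le_abs_self _)

/-- The terms of a convergent series tend to `0`, so that far digits, whose terms are bounded
below, occur at finitely many places only. -/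
theorem digitSum_subset_iUnion_nearFrom (hfar : 0 < liminf (scaledFar c C B) atTop) :
    digitSum C B ⊆ ⋃ K, digitSum C (nearFrom c B K) := by
  intro x hx
  obtain ⟨f, hf, hlim⟩ := mem_digitSum_iff.1 hx
  obtain ⟨ε, hε, hεlim⟩ := exists_between hfar
  have hterm : Tendsto (fun k => ((scale C k)⁻¹ • f k).ofLp) atTop (𝓝 0) := by
    have h1 : Tendsto (fun k => (scale C k)⁻¹ • f k) atTop (𝓝 0) := by
      have := (hlim.comp (tendsto_add_atTop_nat 1)).sub hlim
      rw [sub_self] at this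
      refine this.congr fun k => ?_
      rw [Function.comp_apply, digitPartialSum_succ, add_sub_cancel_left]
    exact ((PiLp.continuous_ofLp 2 fun _ : Fin d => ℝ).tendsto 0).comp h1
  have hsmall : ∀ᶠ k in atTop, ‖((scale C k)⁻¹ • f k).ofLp‖ₑ < ε := by
    have := (continuous_enorm.tendsto _).comp hterm
    rw [enorm_zero] at this
    exact this.eventually_lt_const hε
  obtain ⟨K, hK⟩ := eventually_atTop.1 (hsmall.and (eventually_lt_of_lt_liminf hεlim))
  refine Set.mem_iUnion.2 ⟨K, mem_digitSum_iff.2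
    ⟨f, fun k => mem_nearFrom (hf k) fun hk => ?_, hlim⟩⟩
  by_contra hcube
  exact absurd (scaledFar_le (hf k) hcube) (not_le.2 ((hK k hk).1.trans (hK k hk).2))

/-- If the digits are nonnegative, each term of the series is bounded by the sum; hence near the
given point only near digits are possible from some place on, and `digitSum C B` agrees there with
a compact set. -/
theorem isClosed_digitSum_of_orthant (hc : ∀ k, 1 ≤ c k) (hC : ∀ k, c k + 1 ≤ C k)
    (hfin : ∀ k, (B k).Finite) (horth : ∀ k, B k ⊆ orthant d)
    (hfar : Tendsto (scaledFar c C B) atTop (𝓝 ∞)) : IsClosed (digitSum C B) := by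
  refine isClosed_of_closure_subset fun x hx => ?_
  obtain ⟨K, hK⟩ := eventually_atTop.1
    (hfar.eventually_const_lt (ENNReal.ofReal_lt_top (r := ‖x‖ + 1)))
  have hsub : digitSum C B ∩ Metric.ball x 1 ⊆ digitSum C (nearFrom c B K) := by
    rintro y ⟨hy, hyx⟩
    obtain ⟨f, hf, hlim⟩ := mem_digitSum_iff.1 hy
    refine mem_digitSum_iff.2 ⟨f, fun k => mem_nearFrom (hf k) fun hk => ?_, hlim⟩
    by_contra hcube
    refine absurd (scaledFar_le (C := C) (hf k) hcube) (not_le.2 (lt_of_le_of_lt ?_ (hK k hk)))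
    have hterm : ∀ j i, 0 ≤ ((scale C j)⁻¹ • f j) i := fun j i => by
      have : 0 < (scale C j)⁻¹ := inv_pos.2 (partialScale_pos hc hC (j + 1))
      exact mul_nonneg this.le (horth j (hf j) i)
    have hyn : ‖y‖ ≤ ‖x‖ + 1 := by
      have h1 := Metric.mem_ball.1 hyx
      rw [dist_eq_norm] at h1
      linarith [norm_le_norm_add_norm_sub' y x]
    rw [← ofReal_norm]
    refine ENNReal.ofReal_le_ofReal ((pi_norm_le_iff_of_nonneg (by positivity)).2 fun i => ?_)
    refine le_trans ?_ ((PiLp.norm_apply_le y i).trans hyn)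
    rw [Real.norm_of_nonneg (hterm k i)]
    refine le_trans (ge_of_tendsto (tendsto_apply hlim i)
      ((eventually_gt_atTop k).mono fun n hn => ?_)) (Real.le_norm_self _)
    rw [digitPartialSum, WithLp.ofLp_sum, Finset.sum_apply]
    exact Finset.single_le_sum (f := fun j => ((scale C j)⁻¹ • f j) i) (fun j _ => hterm j i)
      (Finset.mem_range.2 hn)
  have hclosed : IsClosed (digitSum C (nearFrom c B K)) :=
    (isCompact_digitSum hc hC (finite_nearFrom hfin K) (K := K) nearFrom_subset_cube).isClosed
  refine digitSum_nearFrom_subset K (hclosed.closure_subset_iff.2 hsub ?_)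
  rw [Set.inter_comm]
  exact Metric.isOpen_ball.inter_closure ⟨Metric.mem_ball_self one_pos, hx⟩

end NearDigits

end InfSum

theorem corollary1p6 (d : ℕ) (hd : 1 ≤ d) (c C : ℕ → ℝ)
    (B : ℕ → Set (EuclideanSpace ℝ (Fin d)))
    (hc : ∀ k, 1 ≤ c k) (hC : ∀ k, c k + 1 ≤ C k)
    (hfin : ∀ k, (B k).Finite)
    (hne : ∀ k, (B k ∩ InfSum.cube d (c k)).Nonempty)
    (hint : ∀ k, B k ∩ InfSum.cube d (c k) ⊆ InfSum.intLattice d) :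
    (0 < liminf (InfSum.scaledFar c C B) atTop →
      (Tendsto (fun n => ∏ k ∈ Finset.range n, (InfSum.nearCard c B k : ℝ) / C k ^ d)
          atTop (𝓝 0) →
        volume (InfSum.digitSum C B) = 0) ∧
      (Tendsto (fun k => Real.log (C k) / Real.log (InfSum.scale C k)) atTop (𝓝 0) →
        dimH (InfSum.digitSum C B) =
            liminf (fun k => ENNReal.ofReal (InfSum.dimRatio c C B k)) atTop ∧
          InfSum.dimP (InfSum.digitSum C B) =
            limsup (fun k => ENNReal.ofReal (InfSum.dimRatio c C B k)) atTop)) ∧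
    ((∀ k, B k ⊆ InfSum.orthant d) →
      Tendsto (InfSum.scaledFar c C B) atTop (𝓝 ∞) →
      IsClosed (InfSum.digitSum C B)) := by
  open InfSum in
  refine ⟨fun hfar => ⟨fun hprod => ?_, fun hlog => ?_⟩,
    isClosed_digitSum_of_orthant hc hC hfin⟩
  · exact measure_mono_null (digitSum_subset_iUnion_nearFrom hfar)
      (measure_iUnion_null (volume_digitSum_nearFrom_eq_zero hc hC hfin hne hprod))
  have hq0 := partialScale_zero (C := C)
  have hq := two_mul_partialScale_le hc hC
  have hN := wordCount_pos hfin hne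
  have hlog' : Tendsto (fun n => Real.log (partialScale C (n + 1) / partialScale C n) /
      Real.log (partialScale C (n + 1))) atTop (𝓝 0) := by
    refine hlog.congr fun n => ?_
    rw [partialScale_succ, mul_div_cancel_left₀ _ (partialScale_pos hc hC n).ne',
      ← partialScale_succ]
    rfl
  have hcov := isCoveredAtScales_nearFrom hd hc hC hfin hne
  have hsub := digitSum_subset_iUnion_nearFrom hfar
  -- the sums of near digits alone carry the measure that gives the lower bounds
  let F : ℕ → Set (EuclideanSpace ℝ (Fin d)) := fun k => B k ∩ cube d (c k)
  have : ∀ k, Fintype (F k) := fun k => ((hfin k).inter_of_left _).fintype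
  have : ∀ k, Nonempty (F k) := fun k => (hne k).to_subtype
  have hcube : ∀ k, F k ⊆ cube d (c k) := fun k => Set.inter_subset_right
  have hμ : IsFrostman (partialScale C) (wordCount c B) (digitMeasure C F) :=
    isFrostman_digitMeasure hc hC hcube hint
  have hμS : digitMeasure C F (digitSum C B) ≠ 0 := fun h =>
    digitMeasure_digitSum_ne_zero hc hC hcube
      (measure_mono_null (digitSum_mono fun k => Set.inter_subset_left) h)
  refine ⟨le_antisymm ?_ (hμ.le_dimH hq0 hq hN hlog' hμS),
    le_antisymm (dimP_le_of_subset_iUnion hq0 hq hN hlog' hcov hsub) (hμ.le_dimP hq0 hq hN hμS)⟩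
  exact (dimH_mono hsub).trans
    ((dimH_iUnion _).trans_le (iSup_le fun K => (hcov K).dimH_le hq0 hq hN))
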